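/- All matrices are complex. Write $S^*$ for the conjugate transpose of $S$ and $S^{-*}=(S^{-1})^*$. Square matrices $A,B$ of the same size are *congruent if $S^*AS=B$ for some nonsingular $S$, and $A$ is diagonalizable by *congruence if it is *congruent to a diagonal matrix. The *cosquare of a nonsingular matrix $B$ is $B^{-*}B$. Let $J_n(\lambda)$ be the $n\times n$ upper triangular Jordan block with eigenvalue $\lambda$, let $\Delta_n$ be the $n\times n$ matrix with entries $1$ in the positions $(j,k)$ with $j+k=n+1$, entries $i$ in the positions with $j+k=n+2$, and zeros elsewhere, and let $H_{2n}(\mu)=\begin{bmatrix}0&I_n\\J_n(\mu)&0\end{bmatrix}$. A regular part of a square matrix $A$ is a nonsingular (possibly $0\times 0$) matrix $B$ such that $A$ is *congruent to $B\oplus J_{r_1}(0)\oplus\cdots\oplus J_{r_p}(0)$ for some $p\ge 0$ and $r_1,\dots,r_p\ge 1$. A *congruence canonical form of $A$ is a direct sum, *congruent to $A$, of blocks $J_n(0)$, $\lambda\Delta_n$ with $|\lambda|=1$, and $H_{2n}(\mu)$ with $|\mu|>1$ ($n\ge1$). If exactly $k\geq 1$ blocks $e^{i\theta}\Delta_n$,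 $0\le\theta<2\pi$, occur in it, then $\theta$ is a canonical angle of order $n$ of $A$ with multiplicity $k$; if none occurs, the multiplicity of $\theta$ is $0$. (1) A square complex matrix $A$ is diagonalizable by *congruence if and only if both of the following conditions are satisfied: (a) $A$ and $A^*$ have the same null space, and (b) the *cosquare of the regular part of $A$ is diagonalizable (by similarity) and all its eigenvalues have unit modulus. Here (b) may be read equivalently as "$A$ has a regular part with this property" or as "every regular part of $A$ has this property". (2) If $A$ is diagonalizable by *congruence, then for each $\theta\in[0,2\pi)$ the multiplicity of $\theta$ as a canonical angle of order one of $A$ is well defined: $A$ has a *congruence canonical form, and all its *congruence canonical forms give the same multiplicity. Two square complex matrices of the same size that are diagonalizable by *congruence are *congruent if and only if they have the same canonical angles of order one with the same multiplicities. -/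

import Mathlib

open scoped Matrix

namespace StarCongruence

/-- `A` and `B` are *congruent: `Sᴴ * A * S = B` for some nonsingular `S`.  The index types are
allowed to differ (as needed for direct sums); nonsingularity of `S` is expressed by a two-sided
inverse `T`, which for equal index types is the usual notion. -/
def StarCongruent {m n : Type*} [Fintype m] [DecidableEq m] [Fintype n] [DecidableEq n]
    (A : Matrix m m ℂ) (B : Matrix n n ℂ) : Prop :=
  ∃ (S : Matrix m n ℂ) (T : Matrix n m ℂ), S * T = 1 ∧ T * S = 1 ∧ Sᴴ * A * S = B

/-- `A` is diagonalizable by *congruence. -/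
def DiagonalizableByStarCongruence {m : Type*} [Fintype m] [DecidableEq m]
    (A : Matrix m m ℂ) : Prop :=
  ∃ d : m → ℂ, StarCongruent A (Matrix.diagonal d)

/-- `C` is diagonalizable (by similarity). -/
def Diagonalizable {m : Type*} [Fintype m] [DecidableEq m] (C : Matrix m m ℂ) : Prop :=
  ∃ (P : Matrix m m ℂ) (d : m → ℂ), IsUnit P ∧ P⁻¹ * C * P = Matrix.diagonal d

/-- The *cosquare `A^{-*} A` of a nonsingular matrix `A`. -/
noncomputable def starCosquare {m : Type*} [Fintype m] [DecidableEq m] (A : Matrix m m ℂ) :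
    Matrix m m ℂ :=
  (A⁻¹)ᴴ * A

/-- The `n`-by-`n` Jordan block with eigenvalue `lam` and ones on the superdiagonal. -/
def jordanBlock (n : ℕ) (lam : ℂ) : Matrix (Fin n) (Fin n) ℂ :=
  Matrix.of fun i j => if i = j then lam else if (i : ℕ) + 1 = j then 1 else 0

/-- The `n`-by-`n` matrix `Δ_n`, with ones on the antidiagonal, entries `i` on the diagonal just
below it, and zeros elsewhere. -/
noncomputable def deltaBlock (n : ℕ) : Matrix (Fin n) (Fin n) ℂ :=
  Matrix.of fun i j =>
    if (i : ℕ) + j + 1 = n then 1 else if (i : ℕ) + j = n then Complex.I else 0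

/-- The `2n`-by-`2n` matrix `H_{2n}(mu) = [[0, I_n], [J_n(mu), 0]]`. -/
def skewBlock (n : ℕ) (mu : ℂ) : Matrix (Fin (n + n)) (Fin (n + n)) ℂ :=
  Matrix.reindex finSumFinEquiv finSumFinEquiv (Matrix.fromBlocks 0 1 (jordanBlock n mu) 0)

/-- Labels for the blocks `J_n(0)`, `lam Δ_n` and `H_{2n}(mu)`. -/
inductive Block : Type
  | typeZero (n : ℕ) : Block
  | typeOne (n : ℕ) (lam : ℂ) : Block
  | typeTwo (n : ℕ) (mu : ℂ) : Block

/-- The parameters for which a block is a canonical matrix for *congruence. -/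
def Block.IsCanonical : Block → Prop
  | .typeZero n => 1 ≤ n
  | .typeOne n lam => 1 ≤ n ∧ ‖lam‖ = 1
  | .typeTwo n mu => 1 ≤ n ∧ 1 < ‖mu‖

/-- The number of rows of a block. -/
def Block.size : Block → ℕ
  | .typeZero n => n
  | .typeOne n _ => n
  | .typeTwo n _ => n + n

/-- The matrix of a block. -/
noncomputable def Block.toMatrix : (b : Block) → Matrix (Fin b.size) (Fin b.size) ℂ
  | .typeZero n => jordanBlock n 0
  | .typeOne n lam => lam • deltaBlock n
  | .typeTwo n mu => skewBlock n mu

/-- The direct sum of the blocks `c 0, …, c (p - 1)` is a *congruence canonical form of `A`. -/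
def IsCanonicalForm {m : Type*} [Fintype m] [DecidableEq m] (A : Matrix m m ℂ)
    {p : ℕ} (c : Fin p → Block) : Prop :=
  (∀ i, (c i).IsCanonical) ∧
    StarCongruent A (Matrix.blockDiagonal' fun i => (c i).toMatrix)

/-- Exactly `k` blocks `e^{iθ} Δ_r` occur in a *congruence canonical form of `A`.  For `k ≥ 1` and
`0 ≤ θ < 2π` this says that `θ` is a canonical angle of order `r` of `A` with multiplicity `k`;
for `k = 0` it says that `θ` is not a canonical angle of order `r`. -/
def HasCanonicalAngleMultiplicity {m : Type*} [Fintype m] [DecidableEq m] (A : Matrix m m ℂ)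
    (r : ℕ) (θ : ℝ) (k : ℕ) : Prop :=
  ∃ (p : ℕ) (c : Fin p → Block), IsCanonicalForm A c ∧
    {i : Fin p | c i = Block.typeOne r (Complex.exp (θ * Complex.I))}.ncard = k

/-- `R` is a regular part of `A`: `R` is nonsingular and `A` is *congruent to
`R ⊕ J_{r 0}(0) ⊕ ⋯ ⊕ J_{r (p - 1)}(0)`. -/
def IsRegularPart {m l : Type*} [Fintype m] [DecidableEq m] [Fintype l] [DecidableEq l]
    (A : Matrix m m ℂ) (R : Matrix l l ℂ) : Prop :=
  IsUnit R ∧ ∃ (p : ℕ) (r : Fin p → ℕ), (∀ i, 1 ≤ r i) ∧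
    StarCongruent A
      (Matrix.fromBlocks R 0 0 (Matrix.blockDiagonal' fun i => jordanBlock (r i) 0))

/-- `C` is diagonalizable and all its eigenvalues have unit modulus. -/
def DiagonalizableWithUnimodularEigenvalues {m : Type*} [Fintype m] [DecidableEq m]
    (C : Matrix m m ℂ) : Prop :=
  Diagonalizable C ∧ ∀ z : ℂ, Module.End.HasEigenvalue (Matrix.toLin' C) z → ‖z‖ = 1

end StarCongruence

/-! If `A` and `Aᴴ` have the same null space, every zero column of a *congruent matrix sits over a
zero row. No `J_r(0)` with `r ≥ 2` can then occur, and `A` is *congruent to `R ⊕ 0` with `R`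
nonsingular. Zero summands can be cancelled, so everything reduces to `R`. If `R` is *congruent to
`diagonal d`, its cosquare is similar to the diagonal matrix of the unimodular numbers `d i / star
(d i)`. Conversely, if `P` diagonalizes the cosquare to a unitary `D`, then `B = Pᴴ * R * P`
satisfies `B = Bᴴ * D`, which makes `B` normal, hence unitarily diagonalizable
(`diagonalizableByStarCongruence_of_starCosquare`).

Uniqueness of multiplicities is an inertia argument. For `‖lam‖ = 1`, the number of blocks `lam Δ_1`
is the largest dimension of a subspace on which `star lam • A` agrees with its adjoint and has a
positive definite form. This number is a *congruence invariant. The coordinate vectors of those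
blocks span such a subspace, while on every other canonical block the form is nonpositive wherever
the block agrees with its adjoint (`HasPositiveSubspace.le_ncard`). For completeness, diagonal
entries are scaled to be zero or unimodular; the angles then determine the diagonal up to
permutation. -/

namespace StarCongruence

/-! ### *Congruence: equivalence properties, null spaces, cancellation of zero summands. -/

section Basic

variable {m n l : Type*} [Fintype m] [DecidableEq m] [Fintype n] [DecidableEq n]
  [Fintype l] [DecidableEq l]

theorem StarCongruent.symm {A : Matrix m m ℂ} {B : Matrix n n ℂ} (h : StarCongruent A B) :
    StarCongruent B A := by
  obtain ⟨S, T, hST, hTS, rfl⟩ := h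
  refine ⟨T, S, hTS, hST, ?_⟩
  calc Tᴴ * (Sᴴ * A * S) * T = (S * T)ᴴ * A * (S * T) := by
        simp only [Matrix.conjTranspose_mul, Matrix.mul_assoc]
    _ = A := by simp [hST]

theorem StarCongruent.trans {A : Matrix m m ℂ} {B : Matrix n n ℂ} {C : Matrix l l ℂ}
    (h : StarCongruent A B) (h' : StarCongruent B C) : StarCongruent A C := by
  obtain ⟨S, T, hST, hTS, rfl⟩ := h
  obtain ⟨S', T', hST', hTS', rfl⟩ := h'
  refine ⟨S * S', T' * T, ?_, ?_, ?_⟩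
  · rw [Matrix.mul_assoc, ← Matrix.mul_assoc S', hST', Matrix.one_mul, hST]
  · rw [Matrix.mul_assoc, ← Matrix.mul_assoc T, hTS, Matrix.one_mul, hTS']
  · simp only [Matrix.conjTranspose_mul, Matrix.mul_assoc]

theorem starCongruent_submatrix (A : Matrix m m ℂ) (e : n ≃ m) :
    StarCongruent A (A.submatrix e e) := by
  refine ⟨(1 : Matrix m m ℂ).submatrix id e, (1 : Matrix m m ℂ).submatrix e id, ?_, ?_, ?_⟩
  · rw [← Matrix.submatrix_mul _ _ id e id e.bijective]; simp
  · rw [← Matrix.submatrix_mul _ _ e id e Function.bijective_id]; simp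
  · rw [Matrix.conjTranspose_submatrix, Matrix.conjTranspose_one]
    have : A = A.submatrix id id := by simp
    rw [this, ← Matrix.submatrix_mul _ _ e id id Function.bijective_id,
      ← Matrix.submatrix_mul _ _ e id e Function.bijective_id]
    simp

theorem StarCongruent.card_eq {A : Matrix m m ℂ} {B : Matrix n n ℂ} (h : StarCongruent A B) :
    Fintype.card m = Fintype.card n := by
  obtain ⟨S, T, hST, hTS, -⟩ := h
  exact Matrix.square_of_invertible S T hST hTS

theorem starCongruent_diagonal_comp (d : m → ℂ) (e : n ≃ m) :
    StarCongruent (Matrix.diagonal d) (Matrix.diagonal (d ∘ e)) := by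
  simpa using starCongruent_submatrix (Matrix.diagonal d) e

theorem StarCongruent.diagonalizable {A : Matrix m m ℂ} {d : n → ℂ}
    (h : StarCongruent A (Matrix.diagonal d)) : DiagonalizableByStarCongruence A :=
  ⟨_, h.trans (starCongruent_diagonal_comp d (Fintype.equivOfCardEq h.card_eq))⟩

theorem StarCongruent.smul {A : Matrix m m ℂ} {B : Matrix n n ℂ} (h : StarCongruent A B) (a : ℂ) :
    StarCongruent (a • A) (a • B) := by
  obtain ⟨S, T, hST, hTS, rfl⟩ := h
  exact ⟨S, T, hST, hTS, by simp⟩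

theorem StarCongruent.fromBlocks_zero {A : Matrix m m ℂ} {B : Matrix n n ℂ}
    (h : StarCongruent A B) :
    StarCongruent (Matrix.fromBlocks A 0 0 (0 : Matrix l l ℂ))
      (Matrix.fromBlocks B 0 0 (0 : Matrix l l ℂ)) := by
  obtain ⟨S, T, hST, hTS, rfl⟩ := h
  refine ⟨Matrix.fromBlocks S 0 0 1, Matrix.fromBlocks T 0 0 1, ?_, ?_, ?_⟩ <;>
    simp [Matrix.fromBlocks_multiply, Matrix.fromBlocks_conjTranspose, hST, hTS]

/-- The null spaces of `Sᴴ * A * S` and of its adjoint are the preimages under `S` of those of `A`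
and `Aᴴ`. -/
theorem StarCongruent.ker_eq {A : Matrix m m ℂ} {B : Matrix n n ℂ} (h : StarCongruent A B)
    (hA : LinearMap.ker (Matrix.toLin' A) = LinearMap.ker (Matrix.toLin' Aᴴ)) :
    LinearMap.ker (Matrix.toLin' B) = LinearMap.ker (Matrix.toLin' Bᴴ) := by
  obtain ⟨S, T, hST, -, rfl⟩ := h
  have key (M : Matrix m m ℂ) (x : n → ℂ) : (Sᴴ * M * S) *ᵥ x = 0 ↔ M *ᵥ (S *ᵥ x) = 0 := by
    rw [← Matrix.mulVec_mulVec, ← Matrix.mulVec_mulVec]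
    refine ⟨fun hx => ?_, fun hx => by rw [hx, Matrix.mulVec_zero]⟩
    have := congrArg (fun y => Tᴴ *ᵥ y) hx
    simpa [Matrix.mulVec_mulVec, ← Matrix.mul_assoc, ← Matrix.conjTranspose_mul, hST] using this
  ext x
  have hx : A *ᵥ (S *ᵥ x) = 0 ↔ Aᴴ *ᵥ (S *ᵥ x) = 0 := by
    simpa using SetLike.ext_iff.1 hA (S *ᵥ x)
  have : (Sᴴ * A * S)ᴴ = Sᴴ * Aᴴ * S := by
    simp [Matrix.conjTranspose_mul, Matrix.mul_assoc]
  rw [LinearMap.mem_ker, LinearMap.mem_ker, this, Matrix.toLin'_apply, Matrix.toLin'_apply,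
    key, key, hx]

theorem ker_diagonal_eq (d : m → ℂ) :
    LinearMap.ker (Matrix.toLin' (Matrix.diagonal d)) =
      LinearMap.ker (Matrix.toLin' (Matrix.diagonal d)ᴴ) := by
  ext x
  simp [Matrix.diagonal_conjTranspose, funext_iff, Matrix.mulVec_diagonal]

theorem DiagonalizableByStarCongruence.ker_eq {A : Matrix m m ℂ}
    (h : DiagonalizableByStarCongruence A) :
    LinearMap.ker (Matrix.toLin' A) = LinearMap.ker (Matrix.toLin' Aᴴ) := by
  obtain ⟨d, hd⟩ := h
  exact hd.symm.ker_eq (ker_diagonal_eq d)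

/-- If a matrix and its adjoint have the same kernel, then a zero column forces the
corresponding row to vanish. -/
theorem row_eq_zero_of_col_eq_zero {A : Matrix m m ℂ}
    (hA : LinearMap.ker (Matrix.toLin' A) = LinearMap.ker (Matrix.toLin' Aᴴ)) {j : m}
    (hj : ∀ i, A i j = 0) (i : m) : A j i = 0 := by
  have h1 : Pi.single j 1 ∈ LinearMap.ker (Matrix.toLin' A) := by
    simp only [LinearMap.mem_ker, Matrix.toLin'_apply]
    ext i
    simp [hj]
  rw [hA, LinearMap.mem_ker, Matrix.toLin'_apply] at h1
  simpa using congrFun h1 i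

/-- A zero direct summand can be cancelled from nonsingular matrices. -/
theorem StarCongruent.of_fromBlocks_zero {m' n' : Type*} [Fintype m'] [DecidableEq m']
    [Fintype n'] [DecidableEq n'] {A : Matrix m m ℂ} {B : Matrix n n ℂ}
    (hA : IsUnit A) (hB : IsUnit B)
    (h : StarCongruent (Matrix.fromBlocks A 0 0 (0 : Matrix m' m' ℂ))
      (Matrix.fromBlocks B 0 0 (0 : Matrix n' n' ℂ))) : StarCongruent A B := by
  obtain ⟨S, T, hST, hTS, h⟩ := h
  have h1 : Matrix.fromBlocks A 0 0 (0 : Matrix m' m' ℂ) * S =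
      Tᴴ * Matrix.fromBlocks B 0 0 (0 : Matrix n' n' ℂ) := by
    have : Tᴴ * Sᴴ = 1 := by rw [← Matrix.conjTranspose_mul, hST, Matrix.conjTranspose_one]
    rw [← h, ← Matrix.mul_assoc, ← Matrix.mul_assoc, this, Matrix.one_mul]
  have h2 : Sᴴ * Matrix.fromBlocks A 0 0 (0 : Matrix m' m' ℂ) =
      Matrix.fromBlocks B 0 0 (0 : Matrix n' n' ℂ) * T := by
    rw [← h, Matrix.mul_assoc, hST, Matrix.mul_one]
  rw [← Matrix.fromBlocks_toBlocks S, ← Matrix.fromBlocks_toBlocks T] at *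
  simp only [Matrix.fromBlocks_multiply, Matrix.fromBlocks_conjTranspose, Matrix.fromBlocks_inj,
    ← Matrix.fromBlocks_one, Matrix.zero_mul, Matrix.mul_zero, add_zero] at *
  -- The upper right blocks of `h1` and `h2` read `A * S₁₂ = 0` and `B * T₁₂ = 0`, so the upper left
  -- blocks of `S` and `T` are mutually inverse.
  have hS : S.toBlocks₁₂ = 0 := by
    have := congrArg (fun M => A⁻¹ * M) h1.2.1
    simpa [← Matrix.mul_assoc, Matrix.nonsing_inv_mul _ ((Matrix.isUnit_iff_isUnit_det _).1 hA)]
      using this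
  have hT : T.toBlocks₁₂ = 0 := by
    have := congrArg (fun M => B⁻¹ * M) h2.2.1.symm
    simpa [← Matrix.mul_assoc, Matrix.nonsing_inv_mul _ ((Matrix.isUnit_iff_isUnit_det _).1 hB)]
      using this
  refine ⟨S.toBlocks₁₁, T.toBlocks₁₁, ?_, ?_, h.1⟩
  · simpa [hS] using hST.1
  · simpa [hT] using hTS.1

end Basic

/-! ### Nonsingular matrices: diagonalizability through the cosquare. -/

section Cosquare

variable {m : Type*} [Fintype m] [DecidableEq m]

/-- *Congruence of `R` by `S` acts on the cosquare as similarity by `S`, and the cosquare of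
`diagonal d` has entries `d i / star (d i)`. -/
theorem DiagonalizableByStarCongruence.starCosquare {R : Matrix m m ℂ} (hR : IsUnit R)
    (h : DiagonalizableByStarCongruence R) :
    DiagonalizableWithUnimodularEigenvalues (starCosquare R) := by
  obtain ⟨d, h⟩ := h
  obtain ⟨T, S, hTS, hST, hT⟩ := h.symm
  have hSd : Sᴴ * R * S = Matrix.diagonal d := by
    rw [← hT]
    calc Sᴴ * (Tᴴ * Matrix.diagonal d * T) * S
        = (T * S)ᴴ * Matrix.diagonal d * (T * S) := by
          simp only [Matrix.conjTranspose_mul, Matrix.mul_assoc]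
      _ = _ := by simp [hTS]
  have hd (i : m) : d i ≠ 0 := by
    have h1 : IsUnit (Matrix.diagonal d) := by
      rw [← hSd]
      have hS : IsUnit S := IsUnit.of_mul_eq_one_right _ hTS
      exact ((by simpa using hS.star : IsUnit Sᴴ).mul hR).mul hS
    rw [Matrix.isUnit_diagonal, Pi.isUnit_iff] at h1
    exact (h1 i).ne_zero
  have hinv : R⁻¹ = S * Matrix.diagonal d⁻¹ * Sᴴ := by
    apply Matrix.inv_eq_left_inv
    have : Matrix.diagonal d⁻¹ * (Sᴴ * R * S) = 1 := by
      rw [hSd, Matrix.diagonal_mul_diagonal, ← Matrix.diagonal_one]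
      congr 1; ext i; simp [hd i]
    calc S * Matrix.diagonal d⁻¹ * Sᴴ * R
        = S * Matrix.diagonal d⁻¹ * Sᴴ * R * (S * T) := by rw [hST, Matrix.mul_one]
      _ = S * (Matrix.diagonal d⁻¹ * (Sᴴ * R * S)) * T := by simp only [Matrix.mul_assoc]
      _ = 1 := by rw [this, Matrix.mul_one, hST]
  have hco : StarCongruence.starCosquare R = S * Matrix.diagonal (fun i => d i / star (d i)) * T := by
    have h1 : Sᴴ * R = Matrix.diagonal d * T := by
      rw [← hSd, Matrix.mul_assoc, hST, Matrix.mul_one]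
    rw [StarCongruence.starCosquare, hinv]
    simp only [Matrix.conjTranspose_mul, Matrix.conjTranspose_conjTranspose, Matrix.mul_assoc,
      Matrix.diagonal_conjTranspose]
    rw [h1, ← Matrix.mul_assoc (Matrix.diagonal _), Matrix.diagonal_mul_diagonal]
    congr 3
    ext i
    simp [div_eq_inv_mul]
  have hP : S⁻¹ = T := Matrix.inv_eq_left_inv hTS
  have hconj : T * StarCongruence.starCosquare R * S =
      Matrix.diagonal (fun i => d i / star (d i)) := by
    rw [hco]
    calc _ = (T * S) * Matrix.diagonal (fun i => d i / star (d i)) * (T * S) := by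
          simp only [Matrix.mul_assoc]
      _ = _ := by simp [hTS]
  refine ⟨⟨S, _, IsUnit.of_mul_eq_one_right _ hTS, by rw [hP, hconj]⟩, fun z hz => ?_⟩
  obtain ⟨x, hx⟩ := hz.exists_hasEigenvector
  have hxz : StarCongruence.starCosquare R *ᵥ x = z • x := by simpa using hx.apply_eq_smul
  have hy : Matrix.diagonal (fun i => d i / star (d i)) *ᵥ (T *ᵥ x) = z • (T *ᵥ x) := by
    rw [← hconj, Matrix.mulVec_mulVec, Matrix.mul_assoc, hST, Matrix.mul_one,
      ← Matrix.mulVec_mulVec, hxz, Matrix.mulVec_smul]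
  have hne : T *ᵥ x ≠ 0 := fun h0 => hx.2 <| by
    have := congrArg (fun y => S *ᵥ y) h0
    simpa [Matrix.mulVec_mulVec, hST] using this
  obtain ⟨i, hi⟩ := Function.ne_iff.1 hne
  have h2 := congrFun hy i
  rw [Matrix.mulVec_diagonal, Pi.smul_apply, smul_eq_mul] at h2
  rw [← mul_right_cancel₀ hi h2]
  simp [hd i]

/-- Commuting symmetric operators have a common orthonormal eigenbasis. -/
theorem exists_orthonormalBasis_eigenvector_of_commute {E : Type*} [NormedAddCommGroup E]
    [InnerProductSpace ℂ E] [FiniteDimensional ℂ E] {X Y : E →ₗ[ℂ] E} (hX : X.IsSymmetric)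
    (hY : Y.IsSymmetric) (hXY : Commute X Y) {k : ℕ} (hk : Module.finrank ℂ E = k) :
    ∃ b : OrthonormalBasis (Fin k) ℂ E, ∀ a, ∃ p q : ℂ, X (b a) = p • b a ∧ Y (b a) = q • b a := by
  classical
  have hint := LinearMap.IsSymmetric.directSum_isInternal_of_commute hX hY hXY
  have horth := LinearMap.IsSymmetric.orthogonalFamily_eigenspace_inf_eigenspace hX hY
  have hint' := DirectSum.isInternal_ne_bot_iff.2 hint
  have horth' := horth.comp (Subtype.coe_injective (p := fun i : ℂ × ℂ =>
    Module.End.eigenspace X i.2 ⊓ Module.End.eigenspace Y i.1 ≠ ⊥))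
  let := hint.submodule_iSupIndep.fintypeNeBotOfFiniteDimensional
  refine ⟨hint'.subordinateOrthonormalBasis hk horth', fun a => ?_⟩
  obtain ⟨h1, h2⟩ := hint'.subordinateOrthonormalBasis_subordinate hk a horth'
  exact ⟨_, _, Module.End.mem_eigenspace_iff.1 h1, Module.End.mem_eigenspace_iff.1 h2⟩

/-- A normal matrix is diagonalizable by *congruence. -/
theorem diagonalizableByStarCongruence_of_normal {B : Matrix m m ℂ} (hB : Bᴴ * B = B * Bᴴ) :
    DiagonalizableByStarCongruence B := by
  classical
  -- `X` and `Y` are Hermitian, commute because `B` is normal, and give `B = (X - iY) / 2`; a common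
  -- orthonormal eigenbasis therefore diagonalizes `B` unitarily.
  let X : Matrix m m ℂ := B + Bᴴ
  let Y : Matrix m m ℂ := Complex.I • (B - Bᴴ)
  have hX : X.toEuclideanLin.IsSymmetric := by
    rw [Matrix.isSymmetric_toEuclideanLin_iff]
    simp [X, Matrix.IsHermitian, add_comm]
  have hY : Y.toEuclideanLin.IsSymmetric := by
    rw [Matrix.isSymmetric_toEuclideanLin_iff]
    simp only [Y, Matrix.IsHermitian, Matrix.conjTranspose_smul, Matrix.conjTranspose_sub,
      Matrix.conjTranspose_conjTranspose, Complex.star_def, Complex.conj_I]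
    module
  have hXY : X * Y = Y * X := by
    simp only [X, Y, Matrix.mul_smul, Matrix.smul_mul, Matrix.add_mul, Matrix.mul_add,
      Matrix.sub_mul, Matrix.mul_sub, hB]
    module
  have hcomm : Commute X.toEuclideanLin Y.toEuclideanLin := by
    apply LinearMap.ext
    intro v
    simp [Module.End.mul_apply, Matrix.toLpLin_apply, Matrix.mulVec_mulVec, hXY]
  obtain ⟨b, hb⟩ := exists_orthonormalBasis_eigenvector_of_commute hX hY hcomm
    finrank_euclideanSpace
  have hb (a) : ∃ c : ℂ, B *ᵥ (b a).ofLp = c • (b a).ofLp := by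
    obtain ⟨p, q, h1, h2⟩ := hb a
    have h1 := congrArg WithLp.ofLp h1
    have h2 := congrArg WithLp.ofLp h2
    change X *ᵥ (b a).ofLp = p • (b a).ofLp at h1
    change Y *ᵥ (b a).ofLp = q • (b a).ofLp at h2
    refine ⟨(p - Complex.I * q) / 2, ?_⟩
    have hBXY : B = (1 / 2 : ℂ) • (X - Complex.I • Y) := by
      simp only [X, Y, smul_smul, Complex.I_mul_I]
      module
    rw [hBXY, Matrix.smul_mulVec, Matrix.sub_mulVec, Matrix.smul_mulVec, h1, h2]
    module
  choose c hc using hb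
  let S : Matrix m (Fin (Fintype.card m)) ℂ := Matrix.of fun i a => (b a).ofLp i
  have hS : Sᴴ * S = 1 := by
    ext i j
    have := (orthonormal_iff_ite.1 b.orthonormal) i j
    rw [Matrix.one_apply, ← this, EuclideanSpace.inner_eq_star_dotProduct]
    simp [Matrix.mul_apply, S, dotProduct, mul_comm]
  have hBS : B * S = S * Matrix.diagonal c := by
    ext i a
    have := congrFun (hc a) i
    rw [Matrix.mul_diagonal]
    simpa [Matrix.mul_apply, Matrix.mulVec, dotProduct, S, mul_comm] using this
  refine StarCongruent.diagonalizable (d := c) ⟨S, Sᴴ, ?_, hS, ?_⟩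
  · exact (Matrix.mul_eq_one_comm_of_card_eq _ _ _ (by simp)).1 hS
  · rw [Matrix.mul_assoc, hBS, ← Matrix.mul_assoc, hS, Matrix.one_mul]

/-- Writing `R = Rᴴ * C` with `C` the cosquare and passing to `B = Pᴴ * R * P` gives `B = Bᴴ * D`,
hence `Bᴴ = Dᴴ * B` and `B = Dᴴ * B * D`. As the eigenvalues are unimodular, `D` is unitary and so
commutes with `B`; both `Bᴴ * B` and `B * Bᴴ` then equal `Dᴴ * B * B`. -/
theorem diagonalizableByStarCongruence_of_starCosquare {R : Matrix m m ℂ} (hR : IsUnit R)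
    (h : DiagonalizableWithUnimodularEigenvalues (starCosquare R)) :
    DiagonalizableByStarCongruence R := by
  obtain ⟨⟨P, d, hP, hPd⟩, hev⟩ := h
  have hPi : P * P⁻¹ = 1 := Matrix.mul_nonsing_inv _ ((Matrix.isUnit_iff_isUnit_det _).1 hP)
  have hiP : P⁻¹ * P = 1 := Matrix.nonsing_inv_mul _ ((Matrix.isUnit_iff_isUnit_det _).1 hP)
  have hCP : StarCongruence.starCosquare R * P = P * Matrix.diagonal d := by
    rw [← hPd, ← Matrix.mul_assoc, ← Matrix.mul_assoc, hPi, Matrix.one_mul]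
  have hd (i : m) : ‖d i‖ = 1 := by
    apply hev
    apply Module.End.hasEigenvalue_of_hasEigenvector (x := P *ᵥ Pi.single i 1)
    refine ⟨Module.End.mem_eigenspace_iff.2 ?_, fun h0 => ?_⟩
    · rw [Matrix.toLin'_apply, Matrix.mulVec_mulVec, hCP, ← Matrix.mulVec_mulVec,
        Matrix.diagonal_mulVec_single, ← Matrix.mulVec_smul, ← Pi.single_smul', smul_eq_mul]
    · have := congrArg (fun y => P⁻¹ *ᵥ y) h0
      rw [Matrix.mulVec_mulVec, hiP, Matrix.one_mulVec, Matrix.mulVec_zero] at this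
      simpa using congrFun this i
  set D := Matrix.diagonal d with hD
  have hDD : D * Dᴴ = 1 := by
    rw [hD, Matrix.diagonal_conjTranspose, Matrix.diagonal_mul_diagonal, ← Matrix.diagonal_one]
    congr 1
    ext i
    simp [Complex.mul_conj, Complex.normSq_eq_norm_sq, hd i]
  have hDD' : Dᴴ * D = 1 := mul_eq_one_comm.1 hDD
  have hRC : R = Rᴴ * StarCongruence.starCosquare R := by
    rw [StarCongruence.starCosquare, ← Matrix.mul_assoc, ← Matrix.conjTranspose_mul,
      Matrix.nonsing_inv_mul _ ((Matrix.isUnit_iff_isUnit_det _).1 hR), Matrix.conjTranspose_one,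
      Matrix.one_mul]
  set B := Pᴴ * R * P with hB
  have hBD : B = Bᴴ * D := by
    have h1 : Bᴴ = Pᴴ * Rᴴ * P := by simp [hB, Matrix.conjTranspose_mul, Matrix.mul_assoc]
    rw [h1, Matrix.mul_assoc, ← hCP, Matrix.mul_assoc, ← Matrix.mul_assoc Rᴴ, ← hRC, hB,
      Matrix.mul_assoc]
  have hBs : Bᴴ = Dᴴ * B := by
    have : Bᴴ = (Bᴴ * D)ᴴ := congrArg Matrix.conjTranspose hBD
    rwa [Matrix.conjTranspose_mul Bᴴ D, Matrix.conjTranspose_conjTranspose] at this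
  have hcomm : D * B = B * D := by
    conv_lhs => rw [hBD, hBs]
    rw [← Matrix.mul_assoc, ← Matrix.mul_assoc, hDD, Matrix.one_mul]
  have hcomm' : B * Dᴴ = Dᴴ * B := by
    calc B * Dᴴ = Dᴴ * (D * B) * Dᴴ := by rw [← Matrix.mul_assoc, hDD', Matrix.one_mul]
      _ = Dᴴ * B := by rw [hcomm, Matrix.mul_assoc, Matrix.mul_assoc, hDD, Matrix.mul_one]
  have hN : Bᴴ * B = B * Bᴴ := by
    rw [hBs, ← Matrix.mul_assoc B, hcomm']
  obtain ⟨δ, hδ⟩ := diagonalizableByStarCongruence_of_normal hN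
  exact ⟨δ, StarCongruent.trans ⟨P, P⁻¹, hPi, hiP, rfl⟩ hδ⟩

end Cosquare
end StarCongruence

namespace StarCongruence

/-! ### The regular part and the criterion. -/

section RegularPart

variable {m l : Type*} [Fintype m] [DecidableEq m] [Fintype l] [DecidableEq l]

/-- A finite type splits into the indices where a vector does not vanish and those where it does,
the latter being arranged as a family of singletons. -/
theorem exists_equiv_ne_zero_sum_eq_zero {m : Type*} [Fintype m] (d : m → ℂ) :
    ∃ (k p : ℕ) (e : Fin k ⊕ (Σ _ : Fin p, Fin 1) ≃ m),
      (∀ i, d (e (Sum.inl i)) ≠ 0) ∧ ∀ i, d (e (Sum.inr i)) = 0 := by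
  classical
  let e₁ : Fin (Fintype.card {i // d i ≠ 0}) ≃ {i // d i ≠ 0} := (Fintype.equivFin _).symm
  let e₂ : (Σ _ : Fin (Fintype.card {i // ¬ d i ≠ 0}), Fin 1) ≃ {i // ¬ d i ≠ 0} :=
    (Equiv.sigmaUnique _ _).trans (Fintype.equivFin _).symm
  refine ⟨_, _, (e₁.sumCongr e₂).trans (Equiv.sumCompl fun i => d i ≠ 0), fun i => ?_,
    fun i => ?_⟩
  · simpa using (e₁ i).2
  · simpa using (e₂ i).2

theorem blockDiagonal'_jordanBlock_zero_eq_zero {p : ℕ} {r : Fin p → ℕ} (hr : ∀ i, r i ≤ 1) :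
    Matrix.blockDiagonal' (fun i => jordanBlock (r i) 0) = 0 := by
  have h (i) : jordanBlock (r i) 0 = 0 := by
    ext u v
    have := hr i
    have huv : u = v := Fin.ext (by omega)
    simp [jordanBlock, huv]
  simp only [h]
  exact Matrix.blockDiagonal'_zero

/-- Elimination gives `P * A * Q = diagonal d`, so `M = Qᴴ * A * Q` differs from `diagonal d` by an
invertible left factor. Columns of `M` with `d j = 0` vanish, and by the null space condition so do
the corresponding rows. The remaining principal submatrix is the regular part. -/
theorem exists_isRegularPart {A : Matrix m m ℂ}
    (hA : LinearMap.ker (Matrix.toLin' A) = LinearMap.ker (Matrix.toLin' Aᴴ)) :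
    ∃ (k : ℕ) (R : Matrix (Fin k) (Fin k) ℂ), IsRegularPart A R := by
  obtain ⟨L, L', d, hd⟩ := Matrix.Pivot.exists_list_transvec_mul_mul_list_transvec_eq_diagonal A
  set P := (L.map Matrix.TransvectionStruct.toMatrix).prod
  set Q := (L'.map Matrix.TransvectionStruct.toMatrix).prod
  have hP : IsUnit P.det := by simp [P]
  have hQ : IsUnit Q.det := by simp [Q]
  set M := Qᴴ * A * Q with hM
  have hAM : StarCongruent A M :=
    ⟨Q, Q⁻¹, Matrix.mul_nonsing_inv _ hQ, Matrix.nonsing_inv_mul _ hQ, rfl⟩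
  obtain ⟨V, U, hVM, hMU⟩ : ∃ V U : Matrix m m ℂ,
      V * M = Matrix.diagonal d ∧ M = U * Matrix.diagonal d := by
    refine ⟨P * (Q⁻¹)ᴴ, Qᴴ * P⁻¹, ?_, ?_⟩
    · rw [← hd, hM, Matrix.mul_assoc, Matrix.mul_assoc Qᴴ, ← Matrix.mul_assoc _ Qᴴ,
        ← Matrix.conjTranspose_mul, Matrix.mul_nonsing_inv _ hQ, Matrix.conjTranspose_one,
        Matrix.one_mul, Matrix.mul_assoc]
    · rw [← hd, hM, Matrix.mul_assoc Qᴴ P⁻¹, ← Matrix.mul_assoc P⁻¹, ← Matrix.mul_assoc P⁻¹,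
        Matrix.nonsing_inv_mul _ hP, Matrix.one_mul, Matrix.mul_assoc]
  have hcol {j : m} (hj : d j = 0) (i : m) : M i j = 0 := by
    rw [hMU, Matrix.mul_diagonal, hj, mul_zero]
  have hrow {j : m} (hj : d j = 0) (i : m) : M j i = 0 :=
    row_eq_zero_of_col_eq_zero (hAM.ker_eq hA) (hcol hj) i
  obtain ⟨k, p, e, he, he'⟩ := exists_equiv_ne_zero_sum_eq_zero d
  refine ⟨k, M.submatrix (e ∘ Sum.inl) (e ∘ Sum.inl), ?_, p, fun _ => 1, fun _ => le_rfl, ?_⟩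
  -- The vanishing rows of `M` remove the cross terms from `V * M = diagonal d`, which leaves a left
  -- inverse up to the nonzero entries of `d`.
  · have hmul : V.submatrix (e ∘ Sum.inl) (e ∘ Sum.inl) * M.submatrix (e ∘ Sum.inl) (e ∘ Sum.inl)
        = Matrix.diagonal (d ∘ e ∘ Sum.inl) := by
      ext i j
      have h1 := congrFun (congrFun hVM (e (Sum.inl i))) (e (Sum.inl j))
      rw [Matrix.mul_apply, ← e.sum_comp, Fintype.sum_sum_type] at h1
      simp only [hrow (he' _), mul_zero, Finset.sum_const_zero, add_zero] at h1
      rw [Matrix.mul_apply]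
      simpa [Matrix.diagonal_apply] using h1
    apply IsUnit.of_mul_eq_one_right (Matrix.diagonal (d ∘ e ∘ Sum.inl)⁻¹ *
      V.submatrix (e ∘ Sum.inl) (e ∘ Sum.inl))
    rw [Matrix.mul_assoc, hmul, Matrix.diagonal_mul_diagonal, ← Matrix.diagonal_one]
    congr 1
    ext i
    simp [he i]
  · rw [blockDiagonal'_jordanBlock_zero_eq_zero fun _ => le_rfl]
    refine hAM.trans ?_
    convert starCongruent_submatrix M e using 1
    ext (i | i) (j | j) <;> simp [hcol, hrow, he']

/-- If `A` and its adjoint have the same kernel, then the singular part of `A` is zero. -/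
theorem IsRegularPart.exists_starCongruent {A : Matrix m m ℂ} {R : Matrix l l ℂ}
    (hA : LinearMap.ker (Matrix.toLin' A) = LinearMap.ker (Matrix.toLin' Aᴴ))
    (h : IsRegularPart A R) : ∃ (p : ℕ) (r : Fin p → ℕ), StarCongruent A
      (Matrix.fromBlocks R 0 0 (0 : Matrix (Σ i, Fin (r i)) (Σ i, Fin (r i)) ℂ)) := by
  obtain ⟨-, p, r, -, h⟩ := h
  refine ⟨p, r, ?_⟩
  have hr (i) : r i ≤ 1 := by
    by_contra! hi
    let j₀ : Fin (r i) := ⟨0, by omega⟩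
    let j₁ : Fin (r i) := ⟨1, hi⟩
    -- In a nilpotent block of size at least two, column 0 is zero but row 0 has a one in column 1.
    have := row_eq_zero_of_col_eq_zero (h.ker_eq hA) (j := Sum.inr ⟨i, j₀⟩) ?_
      (Sum.inr ⟨i, j₁⟩)
    · simp [jordanBlock, j₀, j₁] at this
    · rintro (u | ⟨k, u⟩)
      · simp
      · by_cases hk : k = i
        · subst hk
          simp [jordanBlock, j₀]
        · simp [Matrix.blockDiagonal'_apply_ne _ _ _ hk]
  rwa [blockDiagonal'_jordanBlock_zero_eq_zero hr] at h

/-- `A` is *congruent both to `R ⊕ 0` and to the nonzero part of its diagonal form plus zeros;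
cancelling the zeros diagonalizes `R`. -/
theorem IsRegularPart.starCosquare {A : Matrix m m ℂ} {R : Matrix l l ℂ}
    (h : IsRegularPart A R) (hA : DiagonalizableByStarCongruence A) :
    DiagonalizableWithUnimodularEigenvalues (starCosquare R) := by
  obtain ⟨p, r, hAR⟩ := h.exists_starCongruent hA.ker_eq
  obtain ⟨d, hd⟩ := hA
  obtain ⟨k, q, e, he, he'⟩ := exists_equiv_ne_zero_sum_eq_zero d
  have hde : Matrix.diagonal (d ∘ e) =
      Matrix.fromBlocks (Matrix.diagonal (d ∘ e ∘ Sum.inl)) 0 0 0 := by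
    ext (i | i) (j | j) <;> simp [Matrix.diagonal_apply, he']
  have h1 := hAR.symm.trans (hd.trans (starCongruent_diagonal_comp d e))
  rw [hde] at h1
  have hu : IsUnit (Matrix.diagonal (d ∘ e ∘ Sum.inl)) := by
    rw [Matrix.isUnit_diagonal, Pi.isUnit_iff]
    exact fun i => (he i).isUnit
  exact (h1.of_fromBlocks_zero h.1 hu).diagonalizable.starCosquare h.1

theorem IsRegularPart.diagonalizableByStarCongruence {A : Matrix m m ℂ} {R : Matrix l l ℂ}
    (h : IsRegularPart A R)
    (hA : LinearMap.ker (Matrix.toLin' A) = LinearMap.ker (Matrix.toLin' Aᴴ))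
    (hR : DiagonalizableWithUnimodularEigenvalues (StarCongruence.starCosquare R)) :
    DiagonalizableByStarCongruence A := by
  obtain ⟨p, r, hAR⟩ := h.exists_starCongruent hA
  obtain ⟨d, hd⟩ := diagonalizableByStarCongruence_of_starCosquare h.1 hR
  have h1 := hAR.trans (hd.fromBlocks_zero (l := Σ i, Fin (r i)))
  have hde : Matrix.fromBlocks (Matrix.diagonal d) 0 0
      (0 : Matrix (Σ i, Fin (r i)) (Σ i, Fin (r i)) ℂ) = Matrix.diagonal (Sum.elim d 0) := by
    ext (i | i) (j | j) <;> simp [Matrix.diagonal_apply]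
  rw [hde] at h1
  exact h1.diagonalizable

end RegularPart
end StarCongruence

namespace StarCongruence

/-! ### Positive subspaces as a *congruence invariant. -/

section Inertia

variable {m n : Type*} [Fintype m] [DecidableEq m] [Fintype n] [DecidableEq n]

/-- There is a `k`-dimensional subspace on which `A` and `Aᴴ` agree and on which the quadratic form
of `A` is positive definite. The subspace is given as the column space of `X`. -/
def HasPositiveSubspace (A : Matrix m m ℂ) (k : ℕ) : Prop :=
  ∃ X : Matrix m (Fin k) ℂ, A * X = Aᴴ * X ∧
    ∀ y, y ≠ 0 → 0 < (star (X *ᵥ y) ⬝ᵥ A *ᵥ (X *ᵥ y)).re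

theorem StarCongruent.hasPositiveSubspace {A : Matrix m m ℂ} {B : Matrix n n ℂ}
    (h : StarCongruent A B) {k : ℕ} (hA : HasPositiveSubspace A k) : HasPositiveSubspace B k := by
  obtain ⟨S, T, hST, -, rfl⟩ := h
  obtain ⟨X, hX, hpos⟩ := hA
  have hS (Z : Matrix m (Fin k) ℂ) : S * (T * Z) = Z := by
    rw [← Matrix.mul_assoc, hST, Matrix.one_mul]
  refine ⟨T * X, ?_, fun y hy => ?_⟩
  · simp only [Matrix.conjTranspose_mul, Matrix.conjTranspose_conjTranspose, Matrix.mul_assoc, hS,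
      hX]
  · convert hpos y hy using 2
    have h1 : S *ᵥ (T * X) *ᵥ y = X *ᵥ y := by rw [Matrix.mulVec_mulVec, hS]
    generalize (T * X) *ᵥ y = z at h1
    rw [← h1, ← Matrix.mulVec_mulVec, ← Matrix.mulVec_mulVec, Matrix.dotProduct_mulVec,
      ← Matrix.star_mulVec]

end Inertia

/-! ### The form of a canonical block on the subspace where it agrees with its adjoint. -/

section Blocks

theorem star_mul_self_of_norm_eq_one {a : ℂ} (ha : ‖a‖ = 1) : star a * a = 1 := by
  rw [mul_comm, Complex.star_def, Complex.mul_conj, Complex.normSq_eq_norm_sq, ha]; simp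

/-- The quadratic form of `N` is nonpositive on the subspace on which `N` and `Nᴴ` agree. -/
def IsNonposOnSelfAdjointPart {m : Type*} [Fintype m] (N : Matrix m m ℂ) : Prop :=
  ∀ x, N *ᵥ x = Nᴴ *ᵥ x → (star x ⬝ᵥ N *ᵥ x).re ≤ 0

/-- Row `k - 1` of `N x = Nᴴ x` reads `a x_k = star a * x_{k-2}`, with the right side absent for `k
= 1`. Hence all odd coordinates (counting from 0) vanish. The form pairs only neighbouring
coordinates, so it is zero. -/
theorem isNonpos_jordanBlock_zero (n : ℕ) {a : ℂ} (ha : a ≠ 0) :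
    IsNonposOnSelfAdjointPart (a • jordanBlock n 0) := by
  intro x hx
  have hN (i j : Fin n) : (a • jordanBlock n 0) i j = if (i : ℕ) + 1 = j then a else 0 := by
    simp only [Matrix.smul_apply, jordanBlock, Matrix.of_apply, smul_eq_mul]
    split_ifs with h1 h2 <;> simp
    subst h1
    omega
  generalize a • jordanBlock n 0 = N at hx hN
  have hodd (k : ℕ) : ∀ hk : k < n, Odd k → x ⟨k, hk⟩ = 0 := by
    induction k using Nat.strong_induction_on with
    | _ k ih =>
      intro hk ho
      have hk0 : 0 < k := ho.pos
      have h1 := congrFun (sub_eq_zero.2 hx) ⟨k - 1, by omega⟩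
      rw [← Matrix.sub_mulVec, Matrix.mulVec, dotProduct,
        Finset.sum_eq_single (⟨k, hk⟩ : Fin n)] at h1
      · have e1 : k - 1 + 1 = k := by omega
        have e2 : k + 1 ≠ k - 1 := by omega
        simpa [hN, e1, e2, ha] using h1
      · intro j _ hj
        by_cases hjk : (j : ℕ) + 1 = k - 1
        · rw [ih j (by omega) j.2 (by obtain ⟨t, ht⟩ := ho; exact ⟨t - 1, by omega⟩), mul_zero]
        · have e1 : k - 1 + 1 ≠ (j : ℕ) := fun h => hj (Fin.ext (by simp; omega))
          simp [hN, e1, hjk]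
      · simp
  refine le_of_eq ?_
  have : star x ⬝ᵥ N *ᵥ x = 0 := by
    simp only [Matrix.mulVec, dotProduct]
    refine Finset.sum_eq_zero fun i _ => ?_
    rcases Nat.even_or_odd (i : ℕ) with hi | hi
    · rw [Finset.sum_eq_zero, mul_zero]
      intro j _
      rw [hN]
      split_ifs with hij
      · rw [hodd j j.2 (hij ▸ hi.add_one), mul_zero]
      · rw [zero_mul]
    · simp [hodd i i.2 hi]
  rw [this, Complex.zero_re]

/-- `K = N - Nᴴ` has `a - star a` on the antidiagonal and `(a + star a) i` just below. For nonreal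
`a` it is nonsingular, so `x = 0`. For `a = ±1` and `n ≥ 2` only the coordinate `x 0` survives, and
`N 0 0 = 0`. For `n = 1` the hypothesis leaves `a = -1`, a negative form. -/
theorem isNonpos_deltaBlock {n : ℕ} {a : ℂ} (ha : ‖a‖ = 1) (h : n = 1 → a ≠ 1) :
    IsNonposOnSelfAdjointPart (a • deltaBlock n) := by
  intro x hx
  have hN (i j : Fin n) : (a • deltaBlock n) i j =
      if (i : ℕ) + j + 1 = n then a else if (i : ℕ) + j = n then a * Complex.I else 0 := by
    simp only [Matrix.smul_apply, deltaBlock, Matrix.of_apply, smul_eq_mul]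
    split_ifs <;> simp
  generalize a • deltaBlock n = N at hx hN
  have hK : (N - Nᴴ) *ᵥ x = 0 := by rw [Matrix.sub_mulVec, hx, sub_self]
  have hKe (i j : Fin n) : (N - Nᴴ) i j = if (i : ℕ) + j + 1 = n then a - star a
      else if (i : ℕ) + j = n then (a + star a) * Complex.I else 0 := by
    simp only [Matrix.sub_apply, Matrix.conjTranspose_apply, hN, add_comm (j : ℕ) i]
    split_ifs <;> simp
    ring
  generalize N - Nᴴ = K at hK hKe
  by_cases hr : a - star a = 0
  · have hreal : star a = a := (sub_eq_zero.1 hr).symm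
    have ha0 : a ≠ 0 := by rintro rfl; simp at ha
    rcases Nat.lt_trichotomy n 1 with hn | rfl | hn
    · obtain rfl : n = 0 := by omega
      simp
    · have h1 : a = -1 := by
        have : a * a = 1 := by
          nth_rewrite 1 [← hreal]
          exact star_mul_self_of_norm_eq_one ha
        exact (mul_self_eq_one_iff.1 this).resolve_left (h rfl)
      simp only [Matrix.mulVec, dotProduct, Fin.sum_univ_one, hN, h1]
      simp
      nlinarith [mul_self_nonneg (x 0).re, mul_self_nonneg (x 0).im]
    · have hx0 (j : Fin n) (hj : (j : ℕ) ≠ 0) : x j = 0 := by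
        have h1 := congrFun hK ⟨n - j, by omega⟩
        rw [Matrix.mulVec, dotProduct, Finset.sum_eq_single j] at h1
        · have e1 : n - j + j = n := by omega
          simpa [hKe, e1, hreal, ha0] using h1
        · intro k _ hk
          have e1 : n - j + k ≠ n := fun h => hk (Fin.ext (by omega))
          simp only [hKe, e1, hr, if_false, ite_self, zero_mul]
        · simp
      refine le_of_eq ?_
      have : star x ⬝ᵥ N *ᵥ x = 0 := by
        simp only [Matrix.mulVec, dotProduct]
        refine Finset.sum_eq_zero fun i _ => ?_
        by_cases hi : (i : ℕ) = 0
        · rw [Finset.sum_eq_zero, mul_zero]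
          intro j _
          by_cases hj : (j : ℕ) = 0
          · have e1 : 1 ≠ n := by omega
            have e2 : 0 ≠ n := by omega
            simp [hN, hi, hj, e1, e2]
          · rw [hx0 j hj, mul_zero]
        · simp [hx0 i hi]
      rw [this, Complex.zero_re]
  -- Reversing the rows makes `K` upper triangular with `a - star a` on the diagonal.
  · have hdet : (K.submatrix Fin.rev id).det ≠ 0 := by
      rw [Matrix.det_of_isUpperTriangular]
      · refine Finset.prod_ne_zero_iff.2 fun i _ => ?_
        have e1 : n - (i + 1) + i + 1 = n := by omega
        simpa [hKe, e1] using hr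
      · intro i j hij
        have hij : (j : ℕ) < i := hij
        have e1 : n - (i + 1) + j + 1 ≠ n := by omega
        have e2 : n - (i + 1) + j ≠ n := by omega
        simp [hKe, e1, e2]
    have hx0 : x = 0 := Matrix.eq_zero_of_mulVec_eq_zero hdet <| by
      ext i
      simpa [Matrix.mulVec, dotProduct] using congrFun hK (Fin.rev i)
    simp [hx0]

/-- For `x = (u, v)` the condition says that `a J - star a` kills `u` and its adjoint kills `v`.
This matrix is triangular with diagonal entry `a * mu - star a`, nonzero because `‖mu‖ > 1`, so `x =
0`. -/
theorem isNonpos_skewBlock (n : ℕ) {a mu : ℂ} (ha : ‖a‖ = 1) (hmu : 1 < ‖mu‖) :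
    IsNonposOnSelfAdjointPart (a • skewBlock n mu) := by
  intro x hx
  have hdet : (a • jordanBlock n mu - star a • (1 : Matrix (Fin n) (Fin n) ℂ)).det ≠ 0 := by
    rw [Matrix.det_of_isUpperTriangular]
    · refine Finset.prod_ne_zero_iff.2 fun i _ => ?_
      simp only [Matrix.sub_apply, Matrix.smul_apply, jordanBlock, Matrix.of_apply, smul_eq_mul,
        if_true, Matrix.one_apply_eq, mul_one]
      intro h0
      have := congrArg norm (sub_eq_zero.1 h0)
      rw [norm_mul, norm_star, ha] at this
      linarith
    · intro i j hij
      have hij : j < i := hij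
      have e1 : (i : ℕ) + 1 ≠ j := by have : (j : ℕ) < i := hij; omega
      simp [jordanBlock, hij.ne', e1]
  let u : Fin n → ℂ := fun i => x (finSumFinEquiv (Sum.inl i))
  let v : Fin n → ℂ := fun i => x (finSumFinEquiv (Sum.inr i))
  have hxuv : x ∘ finSumFinEquiv = Sum.elim u v := by ext (i | i) <;> rfl
  have hM : (a • skewBlock n mu) = (Matrix.fromBlocks 0 (a • 1) (a • jordanBlock n mu) 0).submatrix
      finSumFinEquiv.symm finSumFinEquiv.symm := by
    rw [skewBlock, Matrix.reindex_apply]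
    change (a • Matrix.fromBlocks 0 1 (jordanBlock n mu) 0).submatrix _ _ = _
    rw [Matrix.fromBlocks_smul]
    congr 2 <;> simp
  rw [hM, Matrix.conjTranspose_submatrix, Matrix.submatrix_mulVec_equiv,
    Matrix.submatrix_mulVec_equiv, Equiv.symm_symm, hxuv] at hx
  have hx := (Equiv.surjective finSumFinEquiv.symm).injective_comp_right hx
  rw [Matrix.fromBlocks_conjTranspose, Matrix.fromBlocks_mulVec, Matrix.fromBlocks_mulVec] at hx
  have h1 := congrArg (fun f => f ∘ Sum.inl) hx
  have h2 := congrArg (fun f => f ∘ Sum.inr) hx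
  simp only [Sum.elim_comp_inl, Sum.elim_comp_inr, Matrix.conjTranspose_zero, Matrix.zero_mulVec,
    zero_add, add_zero] at h1 h2
  have hu : u = 0 := Matrix.eq_zero_of_mulVec_eq_zero hdet <| by
    rw [Matrix.sub_mulVec]
    rw [h2]
    simp
  have hv : v = 0 := by
    apply Matrix.eq_zero_of_mulVec_eq_zero (M := (a • jordanBlock n mu - star a •
      (1 : Matrix (Fin n) (Fin n) ℂ))ᴴ)
    · rw [Matrix.det_conjTranspose]
      exact star_ne_zero.2 hdet
    · rw [Matrix.conjTranspose_sub, Matrix.sub_mulVec]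
      rw [← h1]
      simp
  have hx0 : x = 0 := by
    have h0 : x ∘ finSumFinEquiv = 0 := by rw [hxuv, hu, hv]; ext (i | i) <;> rfl
    exact (Equiv.surjective finSumFinEquiv).injective_comp_right h0
  simp [hx0]

theorem Block.IsCanonical.isNonpos {b : Block} (hb : b.IsCanonical) {a : ℂ} (ha : ‖a‖ = 1)
    (hba : b ≠ .typeOne 1 (star a)) : IsNonposOnSelfAdjointPart (a • b.toMatrix) := by
  cases b with
  | typeZero n => exact isNonpos_jordanBlock_zero n (by rintro rfl; simp at ha)
  | typeOne n lam =>
    have hn : ‖lam‖ = 1 := hb.2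
    change IsNonposOnSelfAdjointPart (a • lam • deltaBlock n)
    rw [smul_smul]
    refine isNonpos_deltaBlock (by rw [norm_mul, ha, hn, mul_one]) ?_
    rintro rfl h1
    apply hba
    rw [← mul_one (star a), ← h1, ← mul_assoc, star_mul_self_of_norm_eq_one ha, one_mul]
  | typeTwo n mu => exact isNonpos_skewBlock n ha hb.2

end Blocks
end StarCongruence

namespace StarCongruence

/-! ### Counting the blocks `lam Δ_1` by positive subspaces. -/

section Count

theorem blockDiagonal'_mulVec {ι : Type*} [Fintype ι] [DecidableEq ι] {s : ι → Type*}
    [∀ i, Fintype (s i)] (M : ∀ i, Matrix (s i) (s i) ℂ) (x : (Σ i, s i) → ℂ) (i : ι) (u : s i) :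
    (Matrix.blockDiagonal' M *ᵥ x) ⟨i, u⟩ = (M i *ᵥ fun v => x ⟨i, v⟩) u := by
  rw [Matrix.mulVec, dotProduct, Fintype.sum_sigma, Finset.sum_eq_single i]
  · simp [Matrix.mulVec, dotProduct]
  · intro j _ hj
    simp [Matrix.blockDiagonal'_apply_ne M _ _ hj.symm]
  · simp

theorem ncard_setOf_eq_card {ι : Type*} (P : ι → Prop) [Fintype {i // P i}] :
    {i | P i}.ncard = Fintype.card {i // P i} := by
  rw [← Nat.card_eq_fintype_card]; exact (Nat.card_coe_set_eq _).symm

theorem sigma_fin_ext {ι : Type*} {s : ι → ℕ} {i : ι} (hi : s i = 1) (u v : Fin (s i)) :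
    (⟨i, u⟩ : Σ i, Fin (s i)) = ⟨i, v⟩ :=
  Sigma.ext rfl (heq_of_eq (Fin.ext (by have := u.2; have := v.2; simp only; omega)))

theorem Block.toMatrix_apply_of_eq_typeOne {b : Block} {lam : ℂ} (hb : b = .typeOne 1 lam)
    (u v : Fin b.size) : b.toMatrix u v = lam := by
  subst hb
  have hu : (u : ℕ) < 1 := u.2
  have hv : (v : ℕ) < 1 := v.2
  change lam * (if (u : ℕ) + v + 1 = 1 then 1 else if (u : ℕ) + v = 1 then Complex.I else 0) = lam
  rw [if_pos (by omega), mul_one]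

theorem Block.size_eq_one_of_eq_typeOne {b : Block} {lam : ℂ} (hb : b = .typeOne 1 lam) :
    b.size = 1 := by
  subst hb; rfl

variable {p : ℕ} {c : Fin p → Block} {lam : ℂ}

open scoped ComplexOrder in
-- The scaled matrix and its adjoint fix the coordinate vectors of the blocks `lam Δ_1`, since `star
-- lam * lam = 1`; on their span the form is the squared norm.
theorem hasPositiveSubspace_blockDiagonal' (hlam : ‖lam‖ = 1) :
    HasPositiveSubspace (star lam • Matrix.blockDiagonal' fun i => (c i).toMatrix)
      {i | c i = .typeOne 1 lam}.ncard := by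
  classical
  let e : Fin {i | c i = .typeOne 1 lam}.ncard ≃ {i // c i = .typeOne 1 lam} :=
    (Fintype.equivFinOfCardEq (ncard_setOf_eq_card _).symm).symm
  let f (a : Fin {i | c i = .typeOne 1 lam}.ncard) : Σ i, Fin (c i).size :=
    ⟨(e a).1, ⟨0, by rw [Block.size_eq_one_of_eq_typeOne (e a).2]; exact one_pos⟩⟩
  have hf : Function.Injective f := fun a b hab =>
    e.injective (Subtype.ext (congrArg Sigma.fst hab))
  set A := star lam • Matrix.blockDiagonal' fun i => (c i).toMatrix with hA
  have h1 : star lam * lam = 1 := star_mul_self_of_norm_eq_one hlam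
  have hfa (a) (u) : (⟨(e a).1, u⟩ : Σ i, Fin (c i).size) = f a :=
    sigma_fin_ext (s := fun i => (c i).size) (Block.size_eq_one_of_eq_typeOne (e a).2) _ _
  have hval (a) (k) : A k (f a) = if k = f a then 1 else 0 := by
    obtain ⟨i, u⟩ := k
    by_cases hi : i = (e a).1
    · obtain rfl := hi
      rw [if_pos (hfa a u), hA, Matrix.smul_apply, Matrix.blockDiagonal'_apply_eq,
        Block.toMatrix_apply_of_eq_typeOne (e a).2, smul_eq_mul, h1]
    · rw [if_neg fun h => hi (congrArg Sigma.fst h), hA, Matrix.smul_apply,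
        Matrix.blockDiagonal'_apply_ne _ _ _ hi, smul_zero]
  have hval' (a) (k) : A (f a) k = if k = f a then 1 else 0 := by
    obtain ⟨i, u⟩ := k
    by_cases hi : i = (e a).1
    · obtain rfl := hi
      rw [if_pos (hfa a u), hA, Matrix.smul_apply, Matrix.blockDiagonal'_apply_eq,
        Block.toMatrix_apply_of_eq_typeOne (e a).2, smul_eq_mul, h1]
    · rw [if_neg fun h => hi (congrArg Sigma.fst h), hA, Matrix.smul_apply,
        Matrix.blockDiagonal'_apply_ne _ _ _ (Ne.symm hi), smul_zero]
  let E : Matrix (Σ i, Fin (c i).size) (Fin {i | c i = .typeOne 1 lam}.ncard) ℂ :=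
    (1 : Matrix (Σ i, Fin (c i).size) (Σ i, Fin (c i).size) ℂ).submatrix id f
  have hAE : A * E = E := by
    ext k a
    simp [E, Matrix.mul_apply, Matrix.one_apply, hval]
  have hAE' : Aᴴ * E = E := by
    ext k a
    simp [E, Matrix.mul_apply, Matrix.one_apply, hval']
  have hEE : Eᴴ * E = 1 := by
    rw [Matrix.conjTranspose_submatrix, Matrix.conjTranspose_one,
      ← Matrix.submatrix_mul _ _ f id f Function.bijective_id, Matrix.one_mul,
      Matrix.submatrix_one _ hf]
  refine ⟨E, hAE.trans hAE'.symm, fun y hy => ?_⟩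
  rw [Matrix.mulVec_mulVec, hAE, Matrix.star_mulVec, ← Matrix.dotProduct_mulVec,
    Matrix.mulVec_mulVec, hEE, Matrix.one_mulVec]
  exact (Complex.pos_iff.1 (Matrix.dotProduct_star_self_pos_iff.2 hy)).1

theorem HasPositiveSubspace.le_ncard {k : ℕ} (hc : ∀ i, (c i).IsCanonical) (hlam : ‖lam‖ = 1)
    (h : HasPositiveSubspace (star lam • Matrix.blockDiagonal' fun i => (c i).toMatrix) k) :
    k ≤ {i | c i = .typeOne 1 lam}.ncard := by
  classical
  obtain ⟨X, hX, hpos⟩ := h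
  by_contra! hk
  rw [ncard_setOf_eq_card] at hk
  let f (a : {i // c i = .typeOne 1 lam}) : Σ i, Fin (c i).size :=
    ⟨a.1, ⟨0, by rw [Block.size_eq_one_of_eq_typeOne a.2]; exact one_pos⟩⟩
  -- There are fewer blocks `lam Δ_1` than columns of `X`, so some nonzero `y` makes `X *ᵥ y` vanish
  -- at all their coordinates; the other blocks contribute nonpositively, against positivity.
  obtain ⟨y, hy, hy0⟩ : ∃ y, X.submatrix f id *ᵥ y = 0 ∧ y ≠ 0 := by
    have := LinearMap.ker_ne_bot_of_finrank_lt (f := (X.submatrix f id).mulVecLin)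
      (by simpa using hk)
    obtain ⟨y, hy, hy0⟩ := (Submodule.ne_bot_iff _).1 this
    exact ⟨y, by simpa using hy, hy0⟩
  have hp := hpos y hy0
  have hx0 (a) : (X *ᵥ y) (f a) = 0 := congrFun hy a
  have hxA := congrArg (fun Z => Z *ᵥ y) hX
  simp only [← Matrix.mulVec_mulVec] at hxA
  generalize X *ᵥ y = x at hp hx0 hxA
  rw [← Matrix.blockDiagonal'_smul] at hp hxA
  rw [Matrix.blockDiagonal'_conjTranspose] at hxA
  refine hp.not_ge ?_
  rw [dotProduct, Fintype.sum_sigma, Complex.re_sum]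
  refine Finset.sum_nonpos fun i _ => ?_
  simp only [blockDiagonal'_mulVec]
  by_cases hi : c i = .typeOne 1 lam
  · refine le_of_eq ?_
    rw [Finset.sum_eq_zero, Complex.zero_re]
    intro u _
    have hu : (⟨i, u⟩ : Σ i, Fin (c i).size) = f ⟨i, hi⟩ :=
      sigma_fin_ext (s := fun i => (c i).size) (Block.size_eq_one_of_eq_typeOne hi) _ _
    simp [hu, hx0]
  · refine (hc i).isNonpos (a := star lam) (by simpa using hlam) (by simpa using hi)
      (fun u => x ⟨i, u⟩) ?_
    ext u
    have := congrFun hxA ⟨i, u⟩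
    simpa only [blockDiagonal'_mulVec, Pi.smul_apply] using this

end Count

/-! ### Multiplicities of canonical angles: uniqueness, existence, completeness. -/

section Multiplicity

variable {m n : Type*} [Fintype m] [DecidableEq m] [Fintype n] [DecidableEq n]

theorem HasCanonicalAngleMultiplicity.le {A : Matrix m m ℂ} {θ : ℝ} {k k' : ℕ}
    (h : HasCanonicalAngleMultiplicity A 1 θ k) (h' : HasCanonicalAngleMultiplicity A 1 θ k') :
    k ≤ k' := by
  obtain ⟨p, c, ⟨-, hA⟩, rfl⟩ := h
  obtain ⟨p', c', ⟨hc', hA'⟩, rfl⟩ := h'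
  have hθ : ‖Complex.exp (θ * Complex.I)‖ = 1 := Complex.norm_exp_ofReal_mul_I θ
  exact (((hA.symm.trans hA').smul _).hasPositiveSubspace
    (hasPositiveSubspace_blockDiagonal' hθ)).le_ncard hc' hθ

theorem HasCanonicalAngleMultiplicity.unique {A : Matrix m m ℂ} {θ : ℝ} {k k' : ℕ}
    (h : HasCanonicalAngleMultiplicity A 1 θ k) (h' : HasCanonicalAngleMultiplicity A 1 θ k') :
    k = k' :=
  (h.le h').antisymm (h'.le h)

theorem HasCanonicalAngleMultiplicity.congr {A : Matrix m m ℂ} {B : Matrix n n ℂ} {r : ℕ} {θ : ℝ}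
    {k : ℕ} (hAB : StarCongruent A B) (h : HasCanonicalAngleMultiplicity A r θ k) :
    HasCanonicalAngleMultiplicity B r θ k := by
  obtain ⟨p, c, ⟨hc, hA⟩, rfl⟩ := h
  exact ⟨p, c, ⟨hc, hAB.symm.trans hA⟩, rfl⟩

theorem DiagonalizableByStarCongruence.exists_normalized {A : Matrix m m ℂ}
    (h : DiagonalizableByStarCongruence A) :
    ∃ d : m → ℂ, (∀ i, d i = 0 ∨ ‖d i‖ = 1) ∧ StarCongruent A (Matrix.diagonal d) := by
  obtain ⟨d, hd⟩ := h
  -- Where `d i = 0` the quotient is `0 / 0 = 0`, so zero entries are kept.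
  refine ⟨fun i => d i / ‖d i‖, fun i => ?_, hd.trans ?_⟩
  · by_cases hi : d i = 0
    · simp [hi]
    · simp [hi]
  · let s : m → ℂ := fun i => if d i = 0 then 1 else ((Real.sqrt ‖d i‖)⁻¹ : ℝ)
    have hs (i) : s i ≠ 0 := by
      by_cases hi : d i = 0
      · simp [s, hi]
      · have : Real.sqrt ‖d i‖ ≠ 0 := (Real.sqrt_pos.2 (norm_pos_iff.2 hi)).ne'
        simp [s, hi]
    refine ⟨Matrix.diagonal s, Matrix.diagonal s⁻¹, ?_, ?_, ?_⟩
    · rw [Matrix.diagonal_mul_diagonal, ← Matrix.diagonal_one]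
      congr 1; ext i; simp [hs i]
    · rw [Matrix.diagonal_mul_diagonal, ← Matrix.diagonal_one]
      congr 1; ext i; simp [hs i]
    · rw [Matrix.diagonal_conjTranspose, Matrix.diagonal_mul_diagonal,
        Matrix.diagonal_mul_diagonal]
      congr 1; ext i
      by_cases hi : d i = 0
      · simp [hi]
      · have h2 : ((Real.sqrt ‖d i‖ : ℝ) : ℂ) * (Real.sqrt ‖d i‖ : ℝ) = ‖d i‖ := by
          rw [← Complex.ofReal_mul, Real.mul_self_sqrt (norm_nonneg _)]
        simp only [s, hi, if_false, Pi.star_apply, Complex.star_def, Complex.conj_ofReal, ← h2]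
        rw [Complex.ofReal_inv]
        rw [div_eq_mul_inv, mul_inv]
        ring

open Classical in
/-- The one-by-one canonical block with entry `z`, where `z` is zero or unimodular. -/
noncomputable def Block.ofEntry (z : ℂ) : Block := if z = 0 then .typeZero 1 else .typeOne 1 z

theorem Block.size_ofEntry (z : ℂ) : (Block.ofEntry z).size = 1 := by
  rw [Block.ofEntry]; split_ifs <;> rfl

theorem Block.toMatrix_ofEntry (z : ℂ) (u v : Fin (Block.ofEntry z).size) :
    (Block.ofEntry z).toMatrix u v = z := by
  by_cases hz : z = 0
  · have h : Block.ofEntry z = .typeZero 1 := if_pos hz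
    have hs := Block.size_ofEntry z
    generalize Block.ofEntry z = b at *
    subst h
    have huv : u = v := Fin.ext (by have := u.2; have := v.2; omega)
    rw [huv, hz]
    exact if_pos rfl
  · exact Block.toMatrix_apply_of_eq_typeOne (if_neg hz) u v

theorem Block.isCanonical_ofEntry {z : ℂ} (hz : z = 0 ∨ ‖z‖ = 1) :
    (Block.ofEntry z).IsCanonical := by
  rw [Block.ofEntry]
  split_ifs with h
  · exact le_rfl
  · exact ⟨le_rfl, hz.resolve_left h⟩

theorem hasCanonicalAngleMultiplicity_of_diagonal {k : ℕ} {A : Matrix m m ℂ} {d : Fin k → ℂ}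
    (hd : ∀ i, d i = 0 ∨ ‖d i‖ = 1) (hA : StarCongruent A (Matrix.diagonal d)) (θ : ℝ) :
    HasCanonicalAngleMultiplicity A 1 θ {i | d i = Complex.exp (θ * Complex.I)}.ncard := by
  refine ⟨k, fun i => Block.ofEntry (d i), ⟨fun i => Block.isCanonical_ofEntry (hd i), ?_⟩, ?_⟩
  · let e : (Σ i : Fin k, Fin (Block.ofEntry (d i)).size) ≃ Fin k :=
      { toFun := Sigma.fst
        invFun := fun i => ⟨i, ⟨0, by rw [Block.size_ofEntry]; exact one_pos⟩⟩
        left_inv := fun ⟨i, u⟩ =>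
          sigma_fin_ext (s := fun i => (Block.ofEntry (d i)).size) (Block.size_ofEntry (d i)) _ _
        right_inv := fun _ => rfl }
    refine hA.trans ?_
    convert starCongruent_submatrix (Matrix.diagonal d) e using 1
    ext ⟨i, u⟩ ⟨j, v⟩
    by_cases hij : i = j
    · subst hij
      rw [Matrix.blockDiagonal'_apply_eq, Block.toMatrix_ofEntry]
      simp [e]
    · rw [Matrix.blockDiagonal'_apply_ne _ _ _ hij]
      simp [e, hij]
  · congr 1
    ext i
    simp only [Set.mem_ofPred_eq, Block.ofEntry]
    split_ifs with h
    · simp [h, (Complex.exp_ne_zero _).symm]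
    · simp

theorem exists_mem_Ico_exp_eq {z : ℂ} (hz : ‖z‖ = 1) :
    ∃ θ ∈ Set.Ico (0 : ℝ) (2 * Real.pi), Complex.exp (θ * Complex.I) = z := by
  refine ⟨toIcoMod Real.two_pi_pos 0 z.arg, by simpa using toIcoMod_mem_Ico Real.two_pi_pos 0 z.arg,
    ?_⟩
  have h1 : Complex.exp (z.arg * Complex.I) = z := by
    simpa [hz] using Complex.norm_mul_exp_arg_mul_I z
  rw [← h1, toIcoMod, Complex.exp_eq_exp_iff_exists_int]
  refine ⟨-toIcoDiv Real.two_pi_pos 0 z.arg, ?_⟩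
  rw [h1]
  push_cast [zsmul_eq_mul]
  ring

/-- Two vectors taking every nonzero value equally often agree up to a permutation. -/
theorem exists_perm_of_ncard_eq {m : Type*} [Fintype m] {d d' : m → ℂ}
    (h : ∀ z ≠ 0, {i | d i = z}.ncard = {i | d' i = z}.ncard) :
    ∃ e : m ≃ m, d' ∘ e = d := by
  classical
  have hne : Fintype.card {i // d i ≠ 0} = Fintype.card {i // d' i ≠ 0} := by
    refine Fintype.card_congr ?_
    refine (Equiv.sigmaSubtypeFiberEquivSubtype d (p := (d · ≠ 0)) (q := (· ≠ 0)) fun _ => Iff.rfl).symm.trans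
      (Equiv.trans (Equiv.sigmaCongrRight fun z => Fintype.equivOfCardEq ?_)
        (Equiv.sigmaSubtypeFiberEquivSubtype d' (p := (d' · ≠ 0)) (q := (· ≠ 0)) fun _ => Iff.rfl))
    rw [← ncard_setOf_eq_card, ← ncard_setOf_eq_card, h z z.2]
  have hall (z : ℂ) : Fintype.card {i // d i = z} = Fintype.card {i // d' i = z} := by
    by_cases hz : z = 0
    -- The zero fibres are the complements of the nonzero ones in the same index type, so they too
    -- have equal size.
    · subst hz
      have h1 := Fintype.card_subtype_compl fun i => d i = 0
      have h2 := Fintype.card_subtype_compl fun i => d' i = 0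
      have h3 := Fintype.card_subtype_le fun i => d i = 0
      have h4 := Fintype.card_subtype_le fun i => d' i = 0
      have h5 : Fintype.card {i // ¬ d i = 0} = Fintype.card {i // ¬ d' i = 0} := hne
      omega
    · rw [← ncard_setOf_eq_card, ← ncard_setOf_eq_card, h z hz]
  exact ⟨Equiv.ofFiberEquiv fun z => Fintype.equivOfCardEq (hall z),
    funext fun i => Equiv.ofFiberEquiv_map _ i⟩

/-- In normalized diagonal forms the multiplicity of `θ` counts the entries equal to `e^{iθ}`.
Nonzero values off the unit circle do not occur at all, so equal multiplicities force equal
diagonals up to a permutation. -/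
theorem starCongruent_of_forall_hasCanonicalAngleMultiplicity {k : ℕ}
    {A B : Matrix (Fin k) (Fin k) ℂ} (hA : DiagonalizableByStarCongruence A)
    (hB : DiagonalizableByStarCongruence B)
    (h : ∀ θ ∈ Set.Ico (0 : ℝ) (2 * Real.pi), ∀ r : ℕ,
      (HasCanonicalAngleMultiplicity A 1 θ r ↔ HasCanonicalAngleMultiplicity B 1 θ r)) :
    StarCongruent A B := by
  obtain ⟨d, hd, hAd⟩ := hA.exists_normalized
  obtain ⟨d', hd', hBd⟩ := hB.exists_normalized
  obtain ⟨e, rfl⟩ := exists_perm_of_ncard_eq (d := d) (d' := d') fun z hz => by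
    by_cases hz1 : ‖z‖ = 1
    · obtain ⟨θ, hθ, rfl⟩ := exists_mem_Ico_exp_eq hz1
      exact ((h θ hθ _).1 (hasCanonicalAngleMultiplicity_of_diagonal hd hAd θ)).unique
        (hasCanonicalAngleMultiplicity_of_diagonal hd' hBd θ)
    · have key (f : Fin k → ℂ) (hf : ∀ i, f i = 0 ∨ ‖f i‖ = 1) : {i | f i = z} = ∅ := by
        ext i
        simp only [Set.mem_ofPred_eq, Set.mem_empty_iff_false, iff_false]
        rintro rfl
        exact (hf i).elim hz hz1
      rw [key d hd, key d' hd']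
  exact hAd.trans ((starCongruent_diagonal_comp d' e).symm.trans hBd.symm)

end Multiplicity
end StarCongruence

theorem mainTheorem6 (n : ℕ) :
    -- criterion for diagonalizability by *congruence, for some and for every regular part
    (∀ A : Matrix (Fin n) (Fin n) ℂ,
      (StarCongruence.DiagonalizableByStarCongruence A ↔
        LinearMap.ker (Matrix.toLin' A) = LinearMap.ker (Matrix.toLin' Aᴴ) ∧
        ∃ (m : ℕ) (R : Matrix (Fin m) (Fin m) ℂ), StarCongruence.IsRegularPart A R ∧
          StarCongruence.DiagonalizableWithUnimodularEigenvalues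
            (StarCongruence.starCosquare R)) ∧
      (StarCongruence.DiagonalizableByStarCongruence A ↔
        LinearMap.ker (Matrix.toLin' A) = LinearMap.ker (Matrix.toLin' Aᴴ) ∧
        ∀ (m : ℕ) (R : Matrix (Fin m) (Fin m) ℂ), StarCongruence.IsRegularPart A R →
          StarCongruence.DiagonalizableWithUnimodularEigenvalues
            (StarCongruence.starCosquare R))) ∧
    -- the canonical angles of order one and their multiplicities are well defined
    (∀ A : Matrix (Fin n) (Fin n) ℂ, StarCongruence.DiagonalizableByStarCongruence A →
      ∀ θ ∈ Set.Ico (0 : ℝ) (2 * Real.pi),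
        ∃! k : ℕ, StarCongruence.HasCanonicalAngleMultiplicity A 1 θ k) ∧
    -- they form a complete set of invariants
    (∀ A B : Matrix (Fin n) (Fin n) ℂ, StarCongruence.DiagonalizableByStarCongruence A →
      StarCongruence.DiagonalizableByStarCongruence B →
      (StarCongruence.StarCongruent A B ↔
        ∀ θ ∈ Set.Ico (0 : ℝ) (2 * Real.pi), ∀ k : ℕ,
          (StarCongruence.HasCanonicalAngleMultiplicity A 1 θ k ↔
            StarCongruence.HasCanonicalAngleMultiplicity B 1 θ k))) := by
  refine ⟨fun A => ⟨⟨fun hA => ⟨hA.ker_eq, ?_⟩, ?_⟩, ⟨fun hA => ⟨hA.ker_eq, ?_⟩, ?_⟩⟩,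
    fun A hA θ _ => ?_, fun A B hA hB => ⟨fun hAB θ _ k => ⟨fun h => h.congr hAB,
      fun h => h.congr hAB.symm⟩,
      StarCongruence.starCongruent_of_forall_hasCanonicalAngleMultiplicity hA hB⟩⟩
  · obtain ⟨m, R, hR⟩ := StarCongruence.exists_isRegularPart hA.ker_eq
    exact ⟨m, R, hR, hR.starCosquare hA⟩
  · rintro ⟨hker, m, R, hR, h⟩
    exact hR.diagonalizableByStarCongruence hker h
  · exact fun m R hR => hR.starCosquare hA
  · rintro ⟨hker, h⟩
    obtain ⟨m, R, hR⟩ := StarCongruence.exists_isRegularPart hker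
    exact hR.diagonalizableByStarCongruence hker (h m R hR)
  · obtain ⟨d, hd, hAd⟩ := hA.exists_normalized
    have h := StarCongruence.hasCanonicalAngleMultiplicity_of_diagonal hd hAd θ
    exact ⟨_, h, fun k hk => hk.unique h⟩
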